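/- All spaces are topological spaces and families of subsets are ordered by inclusion. For an infinite cardinal $\kappa$, a partially ordered set is called $\kappa^{\mathrm{op}}$-like if no element of it is below $\kappa$-many elements (every element has fewer than $\kappa$ elements above it). The Noetherian type of a space $X$ is the least infinite cardinal $\kappa$ such that $X$ has a base that is $\kappa^{\mathrm{op}}$-like. A compact linear order is a linearly ordered set that is compact in its order topology. A cardinal is weakly inaccessible if it is an uncountable regular limit cardinal. Theorem. (1) No compact linear order has weakly inaccessible Noetherian type. (2) More generally, if $\kappa$ is weakly inaccessible and $(X_i)_{i\in I}$ is a family of compact linear orders with $|I|<\kappa$, then the product space $\prod_{i\in I}X_i$ does not have Noetherian type $\kappa$. (3) An infinite cardinal $\kappa$ is the Noetherian type of some compact linear order if and only if $\kappa\neq\omega_1$ and $\kappa$ is not weakly inaccessible. -/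

import Mathlib

open Cardinal TopologicalSpace

universe u

/-- A partially ordered set `P` is `κ^op`-like if no element of `P` is below `κ`-many elements,
i.e. every element has fewer than `κ` elements above it. -/
def IsOpLike (κ : Cardinal.{u}) (P : Type u) [PartialOrder P] : Prop :=
  ∀ p : P, #(Set.Ici p) < κ

/-- The infinite cardinals `κ` such that `X` has a `κ^op`-like base. A family of subsets
of `X` is ordered by inclusion. -/
def noetherianCardinals (X : Type u) [TopologicalSpace X] : Set Cardinal.{u} :=
  {κ | ℵ₀ ≤ κ ∧ ∃ B : Set (Set X), IsTopologicalBasis B ∧ IsOpLike κ B}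

/-- The Noetherian type of a topological space `X`: the least infinite cardinal `κ` such that
`X` has a `κ^op`-like base. -/
noncomputable def noetherianType (X : Type u) [TopologicalSpace X] : Cardinal.{u} :=
  sInf (noetherianCardinals X)

/-- There is always such a cardinal, so the infimum defining the Noetherian type is a minimum. -/
theorem noetherianCardinals_nonempty (X : Type u) [TopologicalSpace X] :
    (noetherianCardinals X).Nonempty := by
  refine ⟨max ℵ₀ (Order.succ #(Set (Set X))), le_max_left _ _, {U | IsOpen U},
    isTopologicalBasis_opens, fun p => ?_⟩
  refine lt_of_lt_of_le (Order.lt_succ_of_le ?_) (le_max_right _ _)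
  refine (mk_set_le _).trans ((mk_set_le _).trans ?_)
  rw [mk_set (α := Set X)]
  exact (cantor _).le

theorem noetherianType_mem (X : Type u) [TopologicalSpace X] :
    noetherianType X ∈ noetherianCardinals X :=
  csInf_mem (noetherianCardinals_nonempty X)

/-- A weakly inaccessible cardinal: an uncountable regular limit cardinal. -/
def IsWeaklyInaccessible (κ : Cardinal.{u}) : Prop :=
  ℵ₀ < κ ∧ κ.IsRegular ∧ Order.IsSuccLimit κ

/-! Let `κ` be regular and uncountable. The core fact is that a compact linear order, or a product
of fewer than `κ` of them, whose Noetherian type is at most `κ` has weight less than `κ`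
(`exists_basis_mk_lt`). Pressing down gives this. If some point has character at least `κ` from one
side, a continuous monotone `κ`-sequence runs towards it. Distinct base members chosen at its terms
would, on a stationary set, all contain one nonempty open set, which a `κ^op`-like base forbids. So
all characters are small, and the same pigeonhole shows that each point lies in fewer than `κ` base
members. Mishchenko's theorem then cuts the base down to size less than `κ`. The stationary-set
arguments are packaged as threads, because threads pass to products.

A space of weight `w` has Noetherian type at most the successor of `max ℵ₀ w`. A weakly inaccessible
`κ` is a limit, so type `κ` is impossible. For `κ = ℵ₁` the weight is countable, the space is
metrizable, and its type is `ℵ₀`.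

For the converse, a point realizes `ℵ₀`. The ordinal `μ + 1` realizes `μ` when `μ` is singular, and
the successor of `μ` when `μ` is regular uncountable. The successor of a singular `μ` needs a
lexicographic sum of reversed well-orders. Disjoint stationary sets of blocks have regular lengths
cofinal in `μ`, and pressing down on all of them at once finds a base member with at least `μ`
members above it. -/

section
open Set Filter Topology

/-! ### Regular well-orders and nonstationary sets -/

/-- A linear order of regular cardinality `κ` all of whose proper initial segments have
cardinality less than `κ`. -/
structure IsRegularOrder (κ : Cardinal.{u}) (W : Type u) [LinearOrder W] : Prop where
  isRegular : κ.IsRegular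
  mk_eq : #W = κ
  mk_Iio_lt : ∀ w : W, #(Iio w) < κ

theorem Cardinal.IsRegular.isRegularOrder {κ : Cardinal.{u}} (hκ : κ.IsRegular) :
    IsRegularOrder κ κ.ord.ToType where
  isRegular := hκ
  mk_eq := mk_ord_toType κ
  mk_Iio_lt w := by simpa using Cardinal.mk_Iio_lt w

theorem Cardinal.IsRegular.mk_iUnion_lt {κ : Cardinal.{u}} (hκ : κ.IsRegular) {ι α : Type u}
    (hι : #ι < κ) {t : ι → Set α} (ht : ∀ i, #(t i) < κ) : #(⋃ i, t i) < κ :=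
  (card_iUnion_lt_iff_forall_of_isRegular hκ hι).2 ht

/-- A set is thin if it carries a regressive function that is bounded-to-one in the sense that
the preimage of every initial segment is bounded. On regular uncountable cardinals,
these are the nonstationary sets. -/
def IsThin {W : Type u} [LinearOrder W] (S : Set W) : Prop :=
  ∃ f : W → W, (∀ b ∈ S, ¬ IsMin b → f b < b) ∧ ∀ a, ∃ c, ∀ b ∈ S, f b ≤ a → b ≤ c

namespace IsRegularOrder

variable {κ : Cardinal.{u}} {W : Type u} [LinearOrder W]

theorem mk_Iic_lt (hW : IsRegularOrder κ W) (w : W) : #(Iic w) < κ := by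
  rw [← Iio_insert]
  refine mk_insert_le.trans_lt (add_lt_of_lt hW.isRegular.aleph0_le (hW.mk_Iio_lt w) ?_)
  exact one_lt_aleph0.trans_le hW.isRegular.aleph0_le

theorem exists_gt (hW : IsRegularOrder κ W) {s : Set W} (hs : #s < κ) : ∃ w, ∀ x ∈ s, x < w := by
  by_contra! h
  have : (⋃ x : s, Iic x.1) = Set.univ := by
    refine eq_univ_of_forall fun w => ?_
    obtain ⟨x, hx, hwx⟩ := h w
    exact mem_iUnion.2 ⟨⟨x, hx⟩, hwx⟩
  have h2 := hW.isRegular.mk_iUnion_lt hs (fun x : s => hW.mk_Iic_lt x.1)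
  rw [this, mk_univ, hW.mk_eq] at h2
  exact h2.false

theorem exists_gt_range (hW : IsRegularOrder κ W) {ι : Type u} (hι : #ι < κ) (f : ι → W) :
    ∃ w, ∀ i, f i < w := by
  obtain ⟨w, hw⟩ := hW.exists_gt (mk_range_le.trans_lt hι : #(range f) < κ)
  exact ⟨w, fun i => hw _ ⟨i, rfl⟩⟩

theorem noMaxOrder (hW : IsRegularOrder κ W) : NoMaxOrder W :=
  ⟨fun a => by
    obtain ⟨w, hw⟩ := hW.exists_gt (hW.mk_Iic_lt a)
    exact ⟨w, hw a le_rfl⟩⟩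

theorem nonempty (hW : IsRegularOrder κ W) : Nonempty W := by
  rw [← mk_ne_zero_iff, hW.mk_eq]
  exact hW.isRegular.ne_zero

theorem le_mk_of_unbounded (hW : IsRegularOrder κ W) {S : Set W} (hS : ∀ a, ∃ b ∈ S, a ≤ b) :
    κ ≤ #S := by
  by_contra! h
  obtain ⟨w, hw⟩ := hW.exists_gt h
  obtain ⟨b, hb, hwb⟩ := hS w
  exact (hw b hb).not_ge hwb

end IsRegularOrder

theorem exists_pred {W : Type u} [LinearOrder W] : ∃ p : W → W, ∀ b, ¬ IsMin b → p b < b := by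
  have : ∀ b : W, ∃ c, ¬ IsMin b → c < b := fun b => by
    by_cases h : IsMin b
    · exact ⟨b, fun h' => (h' h).elim⟩
    · obtain ⟨c, hc⟩ := not_isMin_iff.1 h
      exact ⟨c, fun _ => hc⟩
  choose p hp using this
  exact ⟨p, hp⟩

namespace IsThin

variable {κ : Cardinal.{u}} {W : Type u} [LinearOrder W]

theorem of_inter_Ici {S : Set W} {c : W} (h : IsThin (S ∩ Ici c)) : IsThin S := by
  classical
  obtain ⟨f, hf, hb⟩ := h
  obtain ⟨p, hp⟩ := exists_pred (W := W)
  refine ⟨fun b => if c ≤ b then f b else p b, fun b hbS hmin => ?_, fun a => ?_⟩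
  · by_cases h : c ≤ b
    · simpa [h] using hf b ⟨hbS, h⟩ hmin
    · simpa [h] using hp b hmin
  · obtain ⟨d, hd⟩ := hb a
    refine ⟨max c d, fun b hbS hba => ?_⟩
    by_cases h : c ≤ b
    · exact le_max_of_le_right (hd b ⟨hbS, h⟩ (by simpa [h] using hba))
    · exact le_max_of_le_left (le_of_not_ge h)

theorem unbounded_of_not {S : Set W} (h : ¬ IsThin S) (a : W) : ∃ b ∈ S, a ≤ b := by
  by_contra! h'
  refine h (of_inter_Ici (c := a) ?_)
  obtain ⟨p, hp⟩ := exists_pred (W := W)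
  exact ⟨p, fun b _ => hp b, fun _ => ⟨a, fun b hb _ => (h' b hb.1).le⟩⟩

/-- Every regressive function on a non-thin set is constant on a non-thin set. -/
theorem exists_fiber_of_regressive (hW : IsRegularOrder κ W) {S : Set W} (hS : ¬ IsThin S)
    {f : W → W} (hf : ∀ b ∈ S, f b < b) : ∃ a, ¬ IsThin {b ∈ S | f b = a} := by
  by_contra! h
  choose g hg hbd using h
  choose e he using hbd
  -- Diagonal argument: if this maximum is at most `a`, then `b` lies in the fiber of some `x ≤ a`
  -- and below `e x a`. By regularity these fewer than `κ` bounds have a common bound.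
  refine hS ⟨fun b => max (f b) (g (f b) b), fun b hb hmin => ?_, fun a => ?_⟩
  · exact max_lt (hf b hb) (hg _ b ⟨hb, rfl⟩ hmin)
  · obtain ⟨c, hc⟩ := hW.exists_gt_range (hW.mk_Iic_lt a) (fun x => e x.1 a)
    refine ⟨c, fun b hb hba => ?_⟩
    rw [max_le_iff] at hba
    exact (he (f b) a b ⟨hb, rfl⟩ hba.2).trans (hc ⟨f b, hba.1⟩).le

/-- Non-thin sets cannot be split into fewer than `κ` thin pieces. -/
theorem exists_fiber_of_mk_lt (hW : IsRegularOrder κ W) {S : Set W} (hS : ¬ IsThin S)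
    {ι : Type u} (hι : #ι < κ) (f : W → ι) : ∃ i, ¬ IsThin {b ∈ S | f b = i} := by
  by_contra! h
  choose g hg hbd using h
  choose e he using hbd
  refine hS ⟨fun b => g (f b) b, fun b hb hmin => hg _ b ⟨hb, rfl⟩ hmin, fun a => ?_⟩
  obtain ⟨c, hc⟩ := hW.exists_gt_range hι (fun i => e i a)
  exact ⟨c, fun b hb hba => (he (f b) a b ⟨hb, rfl⟩ hba).trans (hc (f b)).le⟩

theorem le_mk_of_not (hW : IsRegularOrder κ W) {S : Set W} (hS : ¬ IsThin S) : κ ≤ #S :=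
  hW.le_mk_of_unbounded (unbounded_of_not hS)

/-- A thinness witness fails at the supremum of an `ω`-sequence that outruns its bounds `e`.
Uncountability of `κ` ensures that this supremum exists. -/
theorem not_setOf_not_isMin [WellFoundedLT W] (hW : IsRegularOrder κ W) (hκ : ℵ₀ < κ) :
    ¬ IsThin {b : W | ¬ IsMin b} := by
  rintro ⟨f, hf, hbd⟩
  choose e he using hbd
  have := hW.noMaxOrder
  have hnext : ∀ a, ∃ a', a < a' ∧ e a < a' := fun a => by
    obtain ⟨c, hc⟩ := exists_gt (max a (e a))
    exact ⟨c, (le_max_left _ _).trans_lt hc, (le_max_right _ _).trans_lt hc⟩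
  choose n hn1 hn2 using hnext
  obtain ⟨w⟩ := hW.nonempty
  let s : ℕ → W := fun k => n^[k] w
  have hs : ∀ k, s (k + 1) = n (s k) := fun k => Function.iterate_succ_apply' n k w
  have hex : ∃ c, ∀ k, s k < c := by
    obtain ⟨c, hc⟩ := hW.exists_gt_range (ι := ULift ℕ) (by simpa using hκ) (fun k => s k.down)
    exact ⟨c, fun k => hc ⟨k⟩⟩
  obtain ⟨c, hc, hmin⟩ := WellFounded.has_min (wellFounded_lt (α := W)) {c | ∀ k, s k < c} hex
  have hcm : ¬ IsMin c := not_isMin_iff.2 ⟨_, hc 0⟩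
  have hfc := hf c hcm hcm
  have : ¬ ∀ k, s k < f c := fun h => hmin _ h hfc
  push Not at this
  obtain ⟨k, hk⟩ := this
  have h1 := he (s k) c hcm hk
  have h2 := hn2 (s k)
  rw [← hs] at h2
  exact (h1.trans_lt h2).not_gt (hc _)

end IsThin

/-- The Ulam matrix argument: a successor cardinal splits into many disjoint non-thin sets. -/
theorem exists_disjoint_not_isThin {μ : Cardinal.{u}} (hμ : ℵ₀ ≤ μ)
    {W : Type u} [LinearOrder W] [WellFoundedLT W] (hW : IsRegularOrder (Order.succ μ) W) :
    ∃ S : W → Set W, (∀ a, ¬ IsThin (S a)) ∧ (∀ a, ∀ b ∈ S a, ¬ IsMin b) ∧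
      ∀ a a' b, b ∈ S a → b ∈ S a' → a = a' := by
  have hinj : ∀ x : W, ∃ g : Iio x → μ.out, Function.Injective g := fun x => by
    have h : #(Iio x) ≤ #μ.out := by rw [mk_out]; exact Order.lt_succ_iff.1 (hW.mk_Iio_lt x)
    obtain ⟨g⟩ := h
    exact ⟨g, g.injective⟩
  choose g hg using hinj
  have hne : Nonempty μ.out := by
    rw [← mk_ne_zero_iff, mk_out]; exact (aleph0_pos.trans_le hμ).ne'
  classical
  let G : W → W → μ.out := fun a x => if h : a < x then g x ⟨a, h⟩ else Classical.arbitrary _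
  have hG : ∀ x a a', a < x → a' < x → G a x = G a' x → a = a' := fun x a a' h h' he => by
    simp only [G, dif_pos h, dif_pos h'] at he
    exact congrArg Subtype.val (hg x he)
  have hκ : ℵ₀ < Order.succ μ := hμ.trans_lt (Order.lt_succ μ)
  have hμl : #μ.out < Order.succ μ := by rw [mk_out]; exact Order.lt_succ μ
  have := hW.noMaxOrder
  have hcol : ∀ a, ∃ i, ¬ IsThin {x | a < x ∧ G a x = i} := fun a => by
    have hpos : ¬ IsThin (Ioi a) := fun h =>
      IsThin.not_setOf_not_isMin hW hκ <| by
        obtain ⟨c, hc⟩ := exists_gt a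
        obtain ⟨f, hf, hb⟩ := h
        refine IsThin.of_inter_Ici (c := c) ⟨f, fun b hb' => hf b (hc.trans_le hb'.2), fun x => ?_⟩
        obtain ⟨d, hd⟩ := hb x
        exact ⟨d, fun b hb' => hd b (hc.trans_le hb'.2)⟩
    exact IsThin.exists_fiber_of_mk_lt hW hpos hμl (G a)
  choose i hi using hcol
  have huniv : ¬ IsThin {b : W | ¬ IsMin b} := IsThin.not_setOf_not_isMin hW hκ
  -- Column `a` of the matrix has a non-thin colour class `i a`. A single colour `j` serves `κ` many
  -- columns, and within one colour the classes are disjoint because each `g x` is injective.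
  obtain ⟨j, hj⟩ := IsThin.exists_fiber_of_mk_lt hW huniv hμl i
  have hcard := IsThin.le_mk_of_not hW hj
  rw [← hW.mk_eq] at hcard
  obtain ⟨φ⟩ := hcard
  refine ⟨fun a => {x | (φ a).1 < x ∧ G (φ a).1 x = j}, fun a => ?_, fun a b hb => ?_, ?_⟩
  · have := hi (φ a).1
    rwa [(φ a).2.2] at this
  · exact not_isMin_iff.2 ⟨_, hb.1⟩
  · rintro a a' b ⟨h1, h2⟩ ⟨h3, h4⟩
    exact φ.injective (Subtype.ext (hG b _ _ h1 h3 (h2.trans h4.symm)))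

/-! ### Point-`<κ` bases of compact spaces -/

/-- Mishchenko's theorem for a regular uncountable cardinal `κ`: if every point of a compact `T₁`
space lies in fewer than `κ` members of a base, then some subfamily of fewer than `κ` members is
still a base. -/
theorem IsTopologicalBasis.exists_subset_mk_lt {κ : Cardinal.{u}} (hκ : κ.IsRegular)
    (hκ' : ℵ₀ < κ) {X : Type u} [TopologicalSpace X] [CompactSpace X] [T1Space X]
    {B : Set (Set X)} (hB : IsTopologicalBasis B) (hp : ∀ p, #{U ∈ B | p ∈ U} < κ) :
    ∃ B' ⊆ B, IsTopologicalBasis B' ∧ #B' < κ := by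
  classical
  -- The minimal finite covers by members of `B`. There are fewer than `κ` of them, and together
  -- their members still form a base.
  let 𝒞 : Set (Finset (Set X)) := {F | (∀ U ∈ F, U ∈ B) ∧ (∀ x, ∃ U ∈ F, x ∈ U) ∧
    ∀ G ⊂ F, ∃ x, ∀ U ∈ G, x ∉ U}
  have key : ∀ (n : ℕ) (A : Finset (Set X)),
      #{F ∈ 𝒞 | A ⊆ F ∧ F.card ≤ A.card + n} < κ := by
    intro n
    induction n with
    | zero =>
      intro A
      refine (mk_le_mk_of_subset (t := {A}) ?_).trans_lt ?_
      · rintro F ⟨-, h1, h2⟩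
        exact (Finset.eq_of_subset_of_card_le h1 (by simpa using h2)).symm
      · rw [mk_singleton]; exact one_lt_aleph0.trans hκ'
    | succ n ih =>
      intro A
      -- If `A` misses `x`, any cover extending `A` contains one of the fewer than `κ` members
      -- through `x`, which can be added to `A`. If `A` already covers, minimality leaves only `F =
      -- A`.
      by_cases hA : ∃ x, ∀ U ∈ A, x ∉ U
      · obtain ⟨x, hx⟩ := hA
        refine (mk_le_mk_of_subset (t := ⋃ U : {U ∈ B | x ∈ U},
          {F ∈ 𝒞 | insert U.1 A ⊆ F ∧ F.card ≤ (insert U.1 A).card + n}) ?_).trans_lt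
          (hκ.mk_iUnion_lt (hp x) fun U => ih _)
        rintro F ⟨hF, hAF, hc⟩
        obtain ⟨U, hUF, hxU⟩ := hF.2.1 x
        refine mem_iUnion.2 ⟨⟨U, hF.1 U hUF, hxU⟩, hF, Finset.insert_subset hUF hAF, ?_⟩
        rw [Finset.card_insert_of_notMem fun h => hx U h hxU]
        omega
      · refine (mk_le_mk_of_subset (t := {A}) ?_).trans_lt ?_
        · rintro F ⟨hF, h1, -⟩
          rcases h1.eq_or_ssubset with h | h
          · exact h.symm
          · exact (hA (hF.2.2 A h)).elim
        · rw [mk_singleton]; exact one_lt_aleph0.trans hκ'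
  have h𝒞 : #𝒞 < κ := by
    refine (mk_le_mk_of_subset (t := ⋃ n : ULift.{u} ℕ,
      {F ∈ 𝒞 | (∅ : Finset (Set X)) ⊆ F ∧ F.card ≤ (∅ : Finset (Set X)).card + n.down})
      ?_).trans_lt (hκ.mk_iUnion_lt (by simpa using hκ') fun n => key _ _)
    intro F hF
    exact mem_iUnion.2 ⟨⟨F.card⟩, hF, by simp, by simp⟩
  refine ⟨⋃ F : 𝒞, {U | U ∈ F.1}, ?_, ?_, hκ.mk_iUnion_lt h𝒞 fun F => ?_⟩
  · rintro U hU
    obtain ⟨F, hF⟩ := mem_iUnion.1 hU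
    exact F.2.1 U hF
  · refine isTopologicalBasis_of_isOpen_of_nhds ?_ ?_
    · rintro U hU
      obtain ⟨F, hF⟩ := mem_iUnion.1 hU
      exact hB.isOpen (F.2.1 U hF)
    · intro x V hxV hV
      obtain ⟨W, hWB, hxW, hWV⟩ := hB.exists_subset_of_mem_open hxV hV
      -- In this cover `W` is the only possible member through `x`, so every minimal subcover must
      -- use `W`.
      have : ∀ y : X, ∃ U ∈ B, y ∈ U ∧ (x ∈ U → U = W) := fun y => by
        by_cases hy : y ∈ W
        · exact ⟨W, hWB, hy, fun _ => rfl⟩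
        · have hyx : y ∈ ({x}ᶜ : Set X) := by
            rintro rfl; exact hy hxW
          obtain ⟨U, hU, hyU, hUx⟩ := hB.exists_subset_of_mem_open hyx isOpen_compl_singleton
          exact ⟨U, hU, hyU, fun h => (hUx h rfl).elim⟩
      choose U hUB hyU hUW using this
      obtain ⟨t, ht⟩ := isCompact_univ.elim_finite_subcover U (fun y => hB.isOpen (hUB y))
        (fun y _ => mem_iUnion.2 ⟨y, hyU y⟩)
      let 𝒟 : Set (Finset (Set X)) := {F | F ⊆ t.image U ∧ ∀ x, ∃ U ∈ F, x ∈ U}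
      have h𝒟 : 𝒟.Nonempty := by
        refine ⟨t.image U, subset_rfl, fun z => ?_⟩
        obtain ⟨y, hy, hz⟩ := mem_iUnion₂.1 (ht (mem_univ z))
        exact ⟨U y, Finset.mem_image_of_mem U hy, hz⟩
      obtain ⟨F, hF, hFmin⟩ := WellFounded.has_min (wellFounded_lt (α := Finset (Set X))) 𝒟 h𝒟
      have hF𝒞 : F ∈ 𝒞 := by
        refine ⟨fun V hV => ?_, hF.2, fun G hG => ?_⟩
        · obtain ⟨y, -, rfl⟩ := Finset.mem_image.1 (hF.1 hV)
          exact hUB y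
        · by_contra! h
          exact hFmin G ⟨hG.subset.trans hF.1, h⟩ hG
      obtain ⟨V', hV'F, hxV'⟩ := hF.2 x
      have : V' = W := by
        obtain ⟨y, -, rfl⟩ := Finset.mem_image.1 (hF.1 hV'F)
        exact hUW y hxV'
      subst this
      exact ⟨V', mem_iUnion.2 ⟨⟨F, hF𝒞⟩, hV'F⟩, hxW, hWV⟩
  · have : #{U | U ∈ F.1} = F.1.card := by
      simp
    rw [this]
    exact natCast_lt_aleph0.trans hκ'

/-! ### Threads -/

/-- A family of points `x b`, `b ∈ W`, is a thread if pressing down works for neighborhoods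
of these points: whenever we choose neighborhoods of the points indexed by a non-thin set,
non-thin many of them contain one and the same nonempty open set. -/
def IsThread {W : Type u} [LinearOrder W] {X : Type u} [TopologicalSpace X] (x : W → X) : Prop :=
  ∀ S : Set W, ¬ IsThin S → (∀ b ∈ S, ¬ IsMin b) → ∀ N : W → Set X, (∀ b ∈ S, N b ∈ 𝓝 (x b)) →
    ∃ O, IsOpen O ∧ O.Nonempty ∧ ∃ S' ⊆ S, ¬ IsThin S' ∧ ∀ b ∈ S', O ⊆ N b

/-- A family of points each of which can be separated from the later ones. -/
def IsRightSeparated {W : Type u} [LinearOrder W] {X : Type u} [TopologicalSpace X]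
    (x : W → X) : Prop :=
  ∀ b, ∃ N ∈ 𝓝 (x b), ∀ c, b < c → x c ∉ N

/-- Either the space has a right separated thread, or all constant families are threads. -/
def ThreadDichotomy (W : Type u) [LinearOrder W] (X : Type u) [TopologicalSpace X] : Prop :=
  (∃ x : W → X, IsThread x ∧ IsRightSeparated x) ∨ ∀ p : X, IsThread fun _ : W => p

section Threads

variable {κ : Cardinal.{u}} {W : Type u} [LinearOrder W]

/-- With fewer than `κ` basic neighborhoods of `p` available, one of them fits inside non-thin many
of the chosen neighborhoods. -/
theorem IsThread.const (hW : IsRegularOrder κ W) {X : Type u} [TopologicalSpace X] {p : X}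
    {C : Set (Set X)} (hC : #C < κ)
    (hp : ∀ N ∈ 𝓝 p, ∃ c ∈ C, IsOpen c ∧ p ∈ c ∧ c ⊆ N) : IsThread fun _ : W => p := by
  intro S hS _ N hN
  have : ∀ b : W, ∃ c : C, IsOpen c.1 ∧ p ∈ c.1 ∧ (b ∈ S → c.1 ⊆ N b) := fun b => by
    by_cases hb : b ∈ S
    · obtain ⟨c, hcC, hc⟩ := hp _ (hN b hb)
      exact ⟨⟨c, hcC⟩, hc.1, hc.2.1, fun _ => hc.2.2⟩
    · obtain ⟨c, hcC, hc⟩ := hp _ univ_mem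
      exact ⟨⟨c, hcC⟩, hc.1, hc.2.1, fun h => (hb h).elim⟩
  choose f hf1 hf2 hf3 using this
  obtain ⟨c, hc⟩ := IsThin.exists_fiber_of_mk_lt hW hS hC f
  obtain ⟨b, hb, -⟩ := IsThin.unbounded_of_not hc hW.nonempty.some
  have hbc : f b = c := hb.2
  refine ⟨c, hbc ▸ hf1 b, ⟨p, hbc ▸ hf2 b⟩, _, sep_subset _ _, hc, fun b hb => ?_⟩
  rw [← hb.2]
  exact hf3 b hb.1

/-- The hypothesis `hc` is left continuity. It makes the left end of a neighborhood of `x b` a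
regressive function of `b`, which is constant on a non-thin set. -/
theorem IsThread.of_strictMono (hW : IsRegularOrder κ W) {X : Type u} [LinearOrder X]
    [TopologicalSpace X] [OrderTopology X] {x : W → X} (hx : StrictMono x)
    (hc : ∀ b, ¬ IsMin b → ∀ y < x b, ∃ a < b, ∀ d, a < d → y ≤ x d) : IsThread x := by
  intro S hS hmin N hN
  have : ∀ b : W, ∃ a, b ∈ S → a < b ∧ ∀ d, a < d → Ioc (x d) (x b) ⊆ N b := fun b => by
    by_cases hb : b ∈ S
    · obtain ⟨m, hm⟩ := not_isMin_iff.1 (hmin b hb)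
      obtain ⟨y, hy, hyN⟩ := exists_Ioc_subset_of_mem_nhds (hN b hb) ⟨x m, hx hm⟩
      obtain ⟨a, hab, ha⟩ := hc b (hmin b hb) y hy
      exact ⟨a, fun _ => ⟨hab, fun d hd => (Ioc_subset_Ioc_left (ha d hd)).trans hyN⟩⟩
    · exact ⟨b, fun h => (hb h).elim⟩
  choose f hf using this
  obtain ⟨a, ha⟩ := IsThin.exists_fiber_of_regressive hW hS fun b hb => (hf b hb).1
  have := hW.noMaxOrder
  obtain ⟨a₁, h₁⟩ := exists_gt a
  obtain ⟨a₂, h₂⟩ := exists_gt a₁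
  obtain ⟨a₃, h₃⟩ := exists_gt a₂
  refine ⟨Ioo (x a₁) (x a₃), isOpen_Ioo, ⟨x a₂, hx h₂, hx h₃⟩, {b ∈ S | f b = a} ∩ Ici a₃,
    fun b hb => hb.1.1, fun h => ha h.of_inter_Ici, ?_⟩
  rintro b ⟨⟨hbS, rfl⟩, hb⟩ z hz
  exact (hf b hbS).2 a₁ h₁ ⟨hz.1, hz.2.le.trans (hx.monotone hb)⟩

/-- There are fewer than `κ` finite supports of basic boxes, so one support `F₀` can be fixed on a
non-thin set. The coordinates in `F₀` are then treated one at a time. This is why threads are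
required to handle every non-thin set and to return a non-thin subset. -/
theorem IsThread.pi (hW : IsRegularOrder κ W) (hκ : ℵ₀ < κ) {ι : Type u} (hι : #ι < κ)
    {X : ι → Type u} [∀ i, TopologicalSpace (X i)] {x : W → ∀ i, X i}
    (hx : ∀ i, IsThread fun b => x b i) : IsThread x := by
  classical
  intro S hS hmin N hN
  have : ∀ b : W, ∃ (F : Finset ι) (t : ∀ i, Set (X i)),
      (∀ i, t i ∈ 𝓝 (x b i)) ∧ (b ∈ S → Set.pi ↑F t ⊆ N b) := fun b => by
    by_cases hb : b ∈ S
    · have h := hN b hb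
      rw [nhds_pi, Filter.mem_pi'] at h
      obtain ⟨F, t, h1, h2⟩ := h
      exact ⟨F, t, h1, fun _ => h2⟩
    · exact ⟨∅, fun _ => Set.univ, fun i => univ_mem, fun h => (hb h).elim⟩
  choose F t ht hFt using this
  have hfin : #(Finset ι) < κ := by
    cases finite_or_infinite ι
    · exact (lt_aleph0_of_finite _).trans hκ
    · rwa [mk_finset_of_infinite]
  obtain ⟨F₀, hF₀⟩ := IsThin.exists_fiber_of_mk_lt hW hS hfin F
  have key : ∀ G : Finset ι, ∃ O : ∀ i, Set (X i), (∀ i, IsOpen (O i) ∧ (O i).Nonempty) ∧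
      ∃ S' ⊆ {b ∈ S | F b = F₀}, ¬ IsThin S' ∧ ∀ b ∈ S', ∀ i ∈ G, O i ⊆ t b i := by
    intro G
    induction G using Finset.induction_on with
    | empty =>
      exact ⟨fun _ => Set.univ, fun i => ⟨isOpen_univ, ⟨x hW.nonempty.some i, trivial⟩⟩,
        _, subset_rfl, hF₀, by simp⟩
    | insert j G hj ih =>
      obtain ⟨O, hO, S', hS', hthin, hsub⟩ := ih
      obtain ⟨V, hV, hVne, S'', hS'', hthin', hsub'⟩ := hx j S' hthin
        (fun b hb => hmin b (hS' hb).1) (fun b => t b j) (fun b _ => ht b j)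
      refine ⟨Function.update O j V, fun i => ?_, S'', hS''.trans hS', hthin', fun b hb i hi => ?_⟩
      · by_cases hij : i = j
        · subst hij; simpa using ⟨hV, hVne⟩
        · simpa [hij] using hO i
      · by_cases hij : i = j
        · subst hij; simpa using hsub' b hb
        · simpa [hij] using hsub b (hS'' hb) i ((Finset.mem_insert.1 hi).resolve_left hij)
  obtain ⟨O, hO, S', hS', hthin, hsub⟩ := key F₀
  choose o ho using fun i => (hO i).2
  refine ⟨Set.pi ↑F₀ O, isOpen_set_pi F₀.finite_toSet fun i _ => (hO i).1, ⟨o, fun i _ => ho i⟩,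
    S', fun b hb => (hS' hb).1, hthin, fun b hb => ?_⟩
  refine Subset.trans ?_ (hFt b (hS' hb).1)
  rw [(hS' hb).2]
  exact Set.pi_mono fun i hi => hsub b hb i hi

/-- Along a thread, members of a `κ^op`-like base cannot be chosen injectively. -/
theorem IsThread.not_injective [WellFoundedLT W] (hW : IsRegularOrder κ W) (hκ : ℵ₀ < κ)
    {X : Type u} [TopologicalSpace X] {B : Set (Set X)} (hB : IsTopologicalBasis B)
    (hlike : IsOpLike κ B) {x : W → X} (hx : IsThread x) {U : W → Set X} (hUB : ∀ b, U b ∈ B)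
    (hxU : ∀ b, x b ∈ U b) : ¬ Function.Injective U := by
  intro hinj
  obtain ⟨O, hO, ⟨z, hz⟩, S', -, hthin, hsub⟩ := hx _ (IsThin.not_setOf_not_isMin hW hκ)
    (fun b hb => hb) U fun b _ => (hB.isOpen (hUB b)).mem_nhds (hxU b)
  obtain ⟨V, hVB, -, hVO⟩ := hB.exists_subset_of_mem_open hz hO
  refine (hlike ⟨V, hVB⟩).not_ge ((IsThin.le_mk_of_not hW hthin).trans ?_)
  let g : S' → Set.Ici (⟨V, hVB⟩ : B) := fun b => ⟨⟨U b, hUB b⟩, hVO.trans (hsub b b.2)⟩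
  refine mk_le_of_injective (f := g) fun b c hbc => Subtype.ext (hinj ?_)
  exact congrArg (fun y => y.1.1) hbc

theorem IsRightSeparated.not_isThread [WellFoundedLT W] (hW : IsRegularOrder κ W) (hκ : ℵ₀ < κ)
    {X : Type u} [TopologicalSpace X] {B : Set (Set X)} (hB : IsTopologicalBasis B)
    (hlike : IsOpLike κ B) {x : W → X} (hsep : IsRightSeparated x) : ¬ IsThread x := by
  intro hx
  choose N hN hNx using hsep
  choose U hUB hxU hUN using fun b => hB.mem_nhds_iff.1 (hN b)
  refine hx.not_injective hW hκ hB hlike hUB hxU fun b c hbc => ?_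
  by_contra hne
  rcases lt_or_gt_of_ne hne with h | h
  · exact hNx b c h (hUN b (hbc ▸ hxU c))
  · exact hNx c b h (hUN c (hbc ▸ hxU b))

/-- A right separated thread is incompatible with the base. Otherwise the constant family at `p` is
a thread, and `κ` many base members through `p` would be an injective choice along it. -/
theorem ThreadDichotomy.mk_lt [WellFoundedLT W] (hW : IsRegularOrder κ W) (hκ : ℵ₀ < κ)
    {X : Type u} [TopologicalSpace X] (hX : ThreadDichotomy W X) {B : Set (Set X)}
    (hB : IsTopologicalBasis B) (hlike : IsOpLike κ B) (p : X) : #{U ∈ B | p ∈ U} < κ := by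
  rcases hX with ⟨x, hx, hsep⟩ | hX
  · exact (hsep.not_isThread hW hκ hB hlike hx).elim
  · by_contra! h
    rw [← hW.mk_eq] at h
    obtain ⟨φ⟩ := h
    exact (hX p).not_injective hW hκ hB hlike (fun b => (φ b).2.1) (fun b => (φ b).2.2)
      (Subtype.val_injective.comp φ.injective)

/-- A right separated thread in one factor, padded with arbitrary threads in the others, stays right
separated through that coordinate. -/
theorem ThreadDichotomy.pi (hW : IsRegularOrder κ W) (hκ : ℵ₀ < κ) {ι : Type u} (hι : #ι < κ)
    {X : ι → Type u} [∀ i, TopologicalSpace (X i)] (hX : ∀ i, ThreadDichotomy W (X i)) :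
    ThreadDichotomy W (∀ i, X i) := by
  classical
  by_cases hne : Nonempty (∀ i, X i)
  swap
  · exact Or.inr fun p => (hne ⟨p⟩).elim
  obtain ⟨p⟩ := hne
  by_cases h : ∃ j, ∃ x : W → X j, IsThread x ∧ IsRightSeparated x
  · obtain ⟨j, y, hy, hsep⟩ := h
    have : ∀ i, ∃ x : W → X i, IsThread x := fun i => by
      rcases hX i with ⟨x, hx, -⟩ | h
      · exact ⟨x, hx⟩
      · exact ⟨_, h (p i)⟩
    choose x hx using this
    refine Or.inl ⟨fun b i => Function.update x j y i b, IsThread.pi hW hκ hι fun i => ?_,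
      fun b => ?_⟩
    · by_cases hij : i = j
      · subst hij; simpa using hy
      · simpa [hij] using hx i
    · obtain ⟨N, hN, hNs⟩ := hsep b
      refine ⟨(fun z => z j) ⁻¹' N, (continuous_apply j).continuousAt.preimage_mem_nhds
        (by simpa using hN), fun c hc => ?_⟩
      simpa using hNs c hc
  · push Not at h
    refine Or.inr fun q => IsThread.pi hW hκ hι fun i => ?_
    rcases hX i with ⟨x, hx, hs⟩ | h'
    · exact (h i x hx hs).elim
    · exact h' (q i)

end Threads

/-! ### Compact linear orders -/

theorem exists_isLUB_of_compactSpace {X : Type u} [LinearOrder X] [TopologicalSpace X]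
    [OrderTopology X] [CompactSpace X] [Nonempty X] (s : Set X) : ∃ a, IsLUB s a := by
  rcases s.eq_empty_or_nonempty with rfl | hs
  · obtain ⟨a, -, ha⟩ := (isCompact_univ (X := X)).exists_isLeast univ_nonempty
    exact ⟨a, by simpa using show IsBot a from fun b => ha (mem_univ b)⟩
  · obtain ⟨a, -, ha⟩ := (isClosed_closure (s := s)).isCompact.exists_isLUB hs.closure
    exact ⟨a, by rwa [IsLUB, upperBounds_closure] at ha⟩

/-- If no set of size less than `κ` is cofinal below `p`, recursion never reaches `p`: at each stage
take the supremum of points `g (x a)` lying strictly between earlier terms and `p`. Suprema give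
continuity, and the gap from `x b` to `g (x b)` gives separation. -/
theorem exists_cofinal_or_exists_thread {κ : Cardinal.{u}} {W : Type u} [LinearOrder W]
    [WellFoundedLT W] (hW : IsRegularOrder κ W) {X : Type u} [LinearOrder X] [TopologicalSpace X]
    [OrderTopology X] [CompactSpace X] (p : X) :
    (∃ C : Set X, #C < κ ∧ (∀ c ∈ C, c < p) ∧ ∀ y < p, ∃ c ∈ C, y ≤ c) ∨
      ∃ x : W → X, IsThread x ∧ IsRightSeparated x := by
  refine or_iff_not_imp_left.2 fun hC => ?_
  push Not at hC
  have : Nonempty X := ⟨p⟩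
  choose s hs using exists_isLUB_of_compactSpace (X := X)
  have hg : ∀ c, ∃ d, c < p → c < d ∧ d < p := fun c => by
    by_cases hc : c < p
    · obtain ⟨y, hy, hcy⟩ := hC {c} (by
        rw [mk_singleton]; exact one_lt_aleph0.trans_le hW.isRegular.aleph0_le) (by simpa using hc)
      exact ⟨y, fun _ => ⟨hcy c rfl, hy⟩⟩
    · exact ⟨c, fun h => (hc h).elim⟩
  choose g hg using hg
  let x : W → X := (wellFounded_lt (α := W)).fix fun b ih =>
    s (range fun a : Iio b => g (ih a.1 a.2))
  have hx : ∀ b, x b = s (range fun a : Iio b => g (x a.1)) := fun b => WellFounded.fix_eq _ _ b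
  have hlub : ∀ b, IsLUB (range fun a : Iio b => g (x a.1)) (x b) := fun b => by
    rw [hx b]; exact hs _
  have hlt : ∀ b, x b < p := fun b => by
    induction b using WellFoundedLT.induction with
    | ind b ih =>
      obtain ⟨y, hy, hlty⟩ := hC (range fun a : Iio b => g (x a.1))
        (mk_range_le.trans_lt (hW.mk_Iio_lt b)) (by
          rintro _ ⟨a, rfl⟩
          exact (hg _ (ih a.1 a.2)).2)
      exact ((hlub b).2 fun c hc => (hlty c hc).le).trans_lt hy
  have hgx : ∀ a b, a < b → g (x a) ≤ x b := fun a b hab => (hlub b).1 ⟨⟨a, hab⟩, rfl⟩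
  have hmono : StrictMono x := fun a b hab => (hg _ (hlt a)).1.trans_le (hgx a b hab)
  refine ⟨x, IsThread.of_strictMono hW hmono fun b _ y hy => ?_, fun b => ?_⟩
  · obtain ⟨_, ⟨a, rfl⟩, ha⟩ := (lt_isLUB_iff (hlub b)).1 hy
    exact ⟨a.1, a.2, fun d hd => ha.le.trans (hgx _ _ hd)⟩
  · have := hW.noMaxOrder
    obtain ⟨c, hbc⟩ := exists_gt b
    exact ⟨Iio (g (x b)), Iio_mem_nhds (hg _ (hlt b)).1, fun d hd h => (hgx b d hd).not_gt h⟩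

theorem threadDichotomy_of_linearOrder {κ : Cardinal.{u}} {W : Type u} [LinearOrder W]
    [WellFoundedLT W] (hW : IsRegularOrder κ W) {X : Type u} [LinearOrder X] [TopologicalSpace X]
    [OrderTopology X] [CompactSpace X] : ThreadDichotomy W X := by
  refine or_iff_not_imp_left.2 fun hbad p => ?_
  obtain ⟨C, hC, hCp, hcof⟩ := (exists_cofinal_or_exists_thread hW p).resolve_right hbad
  have : CompactSpace Xᵒᵈ := ‹CompactSpace X›
  -- Threads and right separation depend only on the topology, so a bad thread in the dual order is
  -- also one in `X`.
  obtain ⟨D, hD, hDp, hcoi⟩ :=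
    (exists_cofinal_or_exists_thread (X := Xᵒᵈ) hW (OrderDual.toDual p)).resolve_right hbad
  let C' : Set (Set X) := insert Set.univ (Ioi '' C)
  let D' : Set (Set X) := insert Set.univ (Iio '' (D : Set X))
  have hκ := hW.isRegular.aleph0_le
  have hC' : #C' < κ := mk_insert_le.trans_lt
    (add_lt_of_lt hκ (mk_image_le.trans_lt hC) (one_lt_aleph0.trans_le hκ))
  have hD' : #D' < κ := mk_insert_le.trans_lt
    (add_lt_of_lt hκ (mk_image_le.trans_lt hD) (one_lt_aleph0.trans_le hκ))
  refine IsThread.const hW (C := range fun q : C' × D' => q.1.1 ∩ q.2.1)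
    (mk_range_le.trans_lt ?_) fun N hN => ?_
  · rw [mk_prod, lift_id, lift_id]
    exact mul_lt_of_lt hκ hC' hD'
  · have h1 : ∃ c ∈ C', IsOpen c ∧ p ∈ c ∧ c ∩ Iic p ⊆ N := by
      by_cases h : ∃ l, l < p
      · obtain ⟨l, hl, hlN⟩ := exists_Ioc_subset_of_mem_nhds hN h
        obtain ⟨c, hc, hlc⟩ := hcof l hl
        exact ⟨_, Or.inr ⟨c, hc, rfl⟩, isOpen_Ioi, hCp c hc, fun z hz =>
          hlN ⟨hlc.trans_lt hz.1, hz.2⟩⟩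
      · push Not at h
        refine ⟨_, Or.inl rfl, isOpen_univ, trivial, fun z hz => ?_⟩
        rw [(h z).antisymm' hz.2]
        exact mem_of_mem_nhds hN
    have h2 : ∃ d ∈ D', IsOpen d ∧ p ∈ d ∧ d ∩ Ici p ⊆ N := by
      by_cases h : ∃ l, p < l
      · obtain ⟨l, hl, hlN⟩ := exists_Ico_subset_of_mem_nhds hN h
        obtain ⟨c, hc, hlc⟩ := hcoi l hl
        exact ⟨_, Or.inr ⟨c, hc, rfl⟩, isOpen_Iio, hDp c hc, fun z hz =>
          hlN ⟨hz.2, lt_of_lt_of_le (α := X) hz.1 hlc⟩⟩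
      · push Not at h
        refine ⟨_, Or.inl rfl, isOpen_univ, trivial, fun z hz => ?_⟩
        rw [(h z).antisymm hz.2]
        exact mem_of_mem_nhds hN
    obtain ⟨c, hcC, hco, hpc, hcN⟩ := h1
    obtain ⟨d, hdD, hdo, hpd, hdN⟩ := h2
    refine ⟨_, ⟨(⟨c, hcC⟩, ⟨d, hdD⟩), rfl⟩, hco.inter hdo, ⟨hpc, hpd⟩, fun z hz => ?_⟩
    rcases le_total z p with h | h
    · exact hcN ⟨hz.1, h⟩
    · exact hdN ⟨hz.2, h⟩

/-! ### Noetherian type and weight -/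

theorem IsOpLike.mono {κ μ : Cardinal.{u}} {P : Type u} [PartialOrder P] (h : IsOpLike κ P)
    (hκμ : κ ≤ μ) : IsOpLike μ P := fun p => (h p).trans_le hκμ

theorem aleph0_le_noetherianType (X : Type u) [TopologicalSpace X] : ℵ₀ ≤ noetherianType X :=
  (noetherianType_mem X).1

theorem noetherianType_le {X : Type u} [TopologicalSpace X] {κ : Cardinal.{u}} (hκ : ℵ₀ ≤ κ)
    {B : Set (Set X)} (hB : IsTopologicalBasis B) (h : IsOpLike κ B) : noetherianType X ≤ κ :=
  csInf_le' ⟨hκ, B, hB, h⟩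

theorem exists_basis_isOpLike {X : Type u} [TopologicalSpace X] {κ : Cardinal.{u}}
    (h : noetherianType X ≤ κ) : ∃ B : Set (Set X), IsTopologicalBasis B ∧ IsOpLike κ B := by
  obtain ⟨-, B, hB, hlike⟩ := noetherianType_mem X
  exact ⟨B, hB, hlike.mono h⟩

theorem noetherianType_le_succ {X : Type u} [TopologicalSpace X] {μ : Cardinal.{u}} (hμ : ℵ₀ ≤ μ)
    {B : Set (Set X)} (hB : IsTopologicalBasis B) (h : #B ≤ μ) :
    noetherianType X ≤ Order.succ μ :=
  noetherianType_le (hμ.trans (Order.le_succ μ)) hB fun _ =>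
    ((mk_set_le _).trans h).trans_lt (Order.lt_succ μ)

theorem exists_basis_mk_lt {κ : Cardinal.{u}} (hκ : κ.IsRegular) (hκ' : ℵ₀ < κ) {X : Type u}
    [TopologicalSpace X] [CompactSpace X] [T1Space X] (hX : ThreadDichotomy κ.ord.ToType X)
    (h : noetherianType X ≤ κ) : ∃ B : Set (Set X), IsTopologicalBasis B ∧ #B < κ := by
  obtain ⟨B, hB, hlike⟩ := exists_basis_isOpLike h
  obtain ⟨B', -, hB'⟩ := IsTopologicalBasis.exists_subset_mk_lt hκ hκ' hB
    (hX.mk_lt hκ.isRegularOrder hκ' hB hlike)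
  exact ⟨B', hB'⟩

/-- Weight below `κ` bounds the type by a successor cardinal, which stays below the limit cardinal
`κ`. -/
theorem IsWeaklyInaccessible.noetherianType_ne {κ : Cardinal.{u}} (hκ : IsWeaklyInaccessible κ)
    {X : Type u} [TopologicalSpace X] [CompactSpace X] [T1Space X]
    (hX : ThreadDichotomy κ.ord.ToType X) : noetherianType X ≠ κ := by
  intro h
  obtain ⟨B, hB, hlt⟩ := exists_basis_mk_lt hκ.2.1 hκ.1 hX h.le
  have h1 := noetherianType_le_succ (le_max_left ℵ₀ #B) hB (le_max_right _ _)
  rw [h] at h1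
  exact h1.not_gt (hκ.2.2.succ_lt (max_lt hκ.1 hlt))

theorem noetherianType_eq_aleph0 {X : Type u} [TopologicalSpace X] [CompactSpace X] [T2Space X]
    [SecondCountableTopology X] : noetherianType X = ℵ₀ := by
  refine (aleph0_le_noetherianType X).antisymm' ?_
  let _ : MetricSpace X := TopologicalSpace.metrizableSpaceMetric X
  have hcov : ∀ n : ℕ, ∃ t : Set X, t.Finite ∧
      Set.univ ⊆ ⋃ x ∈ t, Metric.ball x (1 / ((n : ℝ) + 1)) := fun n => by
    obtain ⟨t, -, ht, h⟩ := isCompact_univ.finite_cover_balls (X := X)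
      (Nat.one_div_pos_of_nat : (0 : ℝ) < 1 / ((n : ℝ) + 1))
    exact ⟨t, ht, h⟩
  choose t ht hcov using hcov
  -- Finitely many balls at each scale. Empty members are excluded, since the empty set would lie
  -- below the whole base.
  let 𝓑 : ℕ → Set (Set X) := fun n =>
    {U | ∃ x ∈ t n, U = Metric.ball x (1 / ((n : ℝ) + 1)) ∧ U.Nonempty}
  have hfin : ∀ n, (𝓑 n).Finite := fun n => ((ht n).image
    fun x => Metric.ball x (1 / ((n : ℝ) + 1))).subset (by
      rintro U ⟨x, hx, rfl, -⟩; exact ⟨x, hx, rfl⟩)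
  have hdist : ∀ n, ∀ U ∈ 𝓑 n, ∀ y ∈ U, ∀ z ∈ U, dist y z < 2 * (1 / ((n : ℝ) + 1)) := by
    rintro n U ⟨x, -, rfl, -⟩ y hy z hz
    have := dist_triangle_right y z x
    rw [Metric.mem_ball] at hy hz
    linarith
  have hsmall : ∀ ε : ℝ, 0 < ε → ∃ n : ℕ, ∀ m, n ≤ m → 2 * (1 / ((m : ℝ) + 1)) < ε := fun ε hε => by
    obtain ⟨n, hn⟩ := exists_nat_one_div_lt (half_pos hε)
    refine ⟨n, fun m hm => ?_⟩
    have := Nat.one_div_le_one_div (α := ℝ) hm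
    linarith
  have hopen : ∀ U ∈ ⋃ n, 𝓑 n, IsOpen U := by
    intro U hU
    obtain ⟨n, x, -, rfl, -⟩ := mem_iUnion.1 hU
    exact Metric.isOpen_ball
  have hmem : ∀ (p : X) (n : ℕ), ∃ U ∈ 𝓑 n, p ∈ U := fun p n => by
    obtain ⟨x, hx, hp⟩ := mem_iUnion₂.1 (hcov n (mem_univ p))
    exact ⟨_, ⟨x, hx, rfl, ⟨p, hp⟩⟩, hp⟩
  have hB : IsTopologicalBasis (⋃ n, 𝓑 n) := by
    refine isTopologicalBasis_of_isOpen_of_nhds hopen fun p V hpV hV => ?_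
    obtain ⟨ε, hε, hεV⟩ := Metric.isOpen_iff.1 hV p hpV
    obtain ⟨n, hn⟩ := hsmall ε hε
    obtain ⟨U, hU, hpU⟩ := hmem p n
    exact ⟨U, mem_iUnion.2 ⟨n, hU⟩, hpU, fun y hy => hεV
      ((hdist n U hU y hy p hpU).trans (hn n le_rfl))⟩
  refine noetherianType_le le_rfl hB fun ⟨V, hV⟩ => ?_
  obtain ⟨p, hp⟩ : V.Nonempty := by
    obtain ⟨n, x, -, -, h⟩ := mem_iUnion.1 hV
    exact h
  obtain ⟨ε, hε, hεV⟩ := Metric.isOpen_iff.1 (hopen V hV) p hp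
  -- A member of small diameter that contains `p` lies in the `ε`-ball inside `V`. Hence only the
  -- finitely many coarse scales contribute proper supersets of `V`.
  have hsup : ∃ n : ℕ, ∀ m, n ≤ m → ∀ U ∈ 𝓑 m, V ⊆ U → U = V := by
    obtain ⟨n, hn⟩ := hsmall ε hε
    refine ⟨n, fun m hm U hU hVU => Subset.antisymm (fun y hy => hεV ?_) hVU⟩
    exact (hdist m U hU y hy p (hVU hp)).trans (hn m hm)
  obtain ⟨n, hn⟩ := hsup
  have hfinite : (insert V (⋃ m ∈ Finset.range n, 𝓑 m)).Finite :=
    (Set.Finite.biUnion (Finset.finite_toSet _) fun m _ => hfin m).insert V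
  have : (Set.Ici (⟨V, hV⟩ : (⋃ n, 𝓑 n : Set (Set X)))).Finite := by
    refine Set.Finite.of_finite_image (f := Subtype.val) (hfinite.subset ?_)
      Subtype.val_injective.injOn
    rintro _ ⟨⟨U, hU⟩, hVU, rfl⟩
    obtain ⟨m, hm⟩ := mem_iUnion.1 hU
    by_cases h : m < n
    · exact Or.inr (mem_iUnion₂.2 ⟨m, Finset.mem_range.2 h, hm⟩)
    · exact Or.inl (hn m (not_lt.1 h) U hm hVU)
  exact this.lt_aleph0

theorem noetherianType_ne_aleph_one {X : Type u} [TopologicalSpace X] [CompactSpace X] [T2Space X]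
    (hX : ThreadDichotomy (ℵ₁ : Cardinal.{u}).ord.ToType X) : noetherianType X ≠ ℵ₁ := by
  intro h
  obtain ⟨B, hB, hlt⟩ := exists_basis_mk_lt isRegular_aleph_one aleph0_lt_aleph_one hX h.le
  have hc : B.Countable := by
    rw [← le_aleph0_iff_set_countable, ← Order.lt_succ_iff, succ_aleph0]
    exact hlt
  have := hB.secondCountableTopology hc
  rw [noetherianType_eq_aleph0] at h
  exact aleph0_lt_aleph_one.ne h

/-! ### Constructing compact linear orders -/

theorem compactSpace_of_isLUB {X : Type u} [LinearOrder X] [TopologicalSpace X] [OrderTopology X]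
    (h : ∀ s : Set X, ∃ a, IsLUB s a) : CompactSpace X := by
  choose f hf using h
  let _ : CompleteLinearOrder X :=
    { ‹LinearOrder X›, LinearOrder.toBiheytingAlgebra X with
      __ := @completeLatticeOfSup X _ ⟨f⟩ hf }
  infer_instance

theorem WellFoundedLT.exists_isLeast {X : Type u} [LinearOrder X] [WellFoundedLT X] {s : Set X}
    (hs : s.Nonempty) : ∃ a, IsLeast s a := by
  obtain ⟨a, ha, hmin⟩ := WellFounded.has_min (wellFounded_lt (α := X)) s hs
  exact ⟨a, ha, fun b hb => not_lt.1 (hmin b hb)⟩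

theorem compactSpace_of_wellFoundedLT {X : Type u} [LinearOrder X] [WellFoundedLT X] [OrderTop X]
    [TopologicalSpace X] [OrderTopology X] : CompactSpace X :=
  compactSpace_of_isLUB fun s =>
    WellFoundedLT.exists_isLeast (s := upperBounds s) ⟨⊤, fun _ _ => le_top⟩

theorem exists_basis_mk_le {X : Type u} [LinearOrder X] [TopologicalSpace X] [OrderTopology X]
    {μ : Cardinal.{u}} (hμ : ℵ₀ ≤ μ) (hX : #X ≤ μ) :
    ∃ B : Set (Set X), IsTopologicalBasis B ∧ #B ≤ μ := by
  classical
  refine ⟨_, isTopologicalBasis_of_subbasis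
    (OrderTopology.topology_eq_generate_intervals (α := X)), mk_image_le.trans ?_⟩
  set s : Set (Set X) := {s | ∃ a, s = Ioi a ∨ s = Iio a} with hs
  have h1 : #s ≤ μ := by
    have : s ⊆ range (Ioi : X → Set X) ∪ range (Iio : X → Set X) := by
      rintro _ ⟨a, rfl | rfl⟩
      · exact Or.inl ⟨a, rfl⟩
      · exact Or.inr ⟨a, rfl⟩
    refine (mk_le_mk_of_subset this).trans ((mk_union_le _ _).trans ?_)
    exact add_le_of_le hμ (mk_range_le.trans hX) (mk_range_le.trans hX)
  have h2 : #(Finset s) ≤ μ := by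
    cases finite_or_infinite s
    · exact (lt_aleph0_of_finite _).le.trans hμ
    · rwa [mk_finset_of_infinite]
  refine le_trans ?_ h2
  refine mk_le_of_surjective (f := fun F : Finset s =>
    (⟨Subtype.val '' (F : Set s), F.finite_toSet.image _, by simp⟩ :
      {f : Set (Set X) | f.Finite ∧ f ⊆ s})) ?_
  rintro ⟨f, hf, hfs⟩
  refine ⟨(hf.preimage Subtype.val_injective.injOn : (Subtype.val ⁻¹' f : Set s).Finite).toFinset,
    Subtype.ext ?_⟩
  simpa using hfs

theorem Cardinal.IsRegular.noMaxOrder {κ : Cardinal.{u}} (hκ : κ.IsRegular) :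
    NoMaxOrder κ.ord.ToType := hκ.isRegularOrder.noMaxOrder

section WellOrder

variable {K : Type u} [LinearOrder K] [WellFoundedLT K]

/-- Successor points are isolated, so their singletons belong to every base. -/
theorem mk_le_mk_basis_withTop [NoMaxOrder K] [TopologicalSpace (WithTop K)]
    [OrderTopology (WithTop K)] {B : Set (Set (WithTop K))} (hB : IsTopologicalBasis B) :
    #K ≤ #B := by
  have hs : ∀ a : K, ∃ b, IsLeast (Ioi a) b := fun a =>
    WellFoundedLT.exists_isLeast (exists_gt a)
  choose s hs using hs
  have hopen : ∀ a : K, Ioo (a : WithTop K) (s (s a) : WithTop K) = {(s a : WithTop K)} := fun a => by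
    ext x
    rw [mem_Ioo, mem_singleton_iff]
    constructor
    · rintro ⟨h1, h2⟩
      obtain ⟨x, rfl⟩ := WithTop.ne_top_iff_exists.1 (h2.trans (WithTop.coe_lt_top _)).ne
      rw [WithTop.coe_lt_coe] at h1 h2
      have h3 : s a ≤ x := (hs a).2 h1
      rcases h3.eq_or_lt with h | h
      · rw [h]
      · exact (h2.not_ge ((hs (s a)).2 h)).elim
    · rintro rfl
      exact ⟨WithTop.coe_lt_coe.2 (hs a).1, WithTop.coe_lt_coe.2 (hs (s a)).1⟩
  have hmem : ∀ a : K, {(s a : WithTop K)} ∈ B := fun a => by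
    obtain ⟨U, hUB, haU, hU⟩ := hB.exists_subset_of_mem_open (mem_singleton (s a : WithTop K))
      (hopen a ▸ isOpen_Ioo)
    rwa [← (subset_antisymm hU (singleton_subset_iff.2 haU))]
  refine mk_le_of_injective (f := fun a => (⟨_, hmem a⟩ : B)) fun a b hab => ?_
  have h : s a = s b := by simpa using hab
  rcases lt_trichotomy a b with h' | h' | h'
  · exact ((hs b).1.not_ge (h ▸ (hs a).2 h')).elim
  · exact h'
  · exact ((hs a).1.not_ge (h ▸ (hs b).2 h')).elim

/-- Otherwise the weight would be less than `ν`, while every base has at least `#K` members. -/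
theorem lt_noetherianType_withTop [NoMaxOrder K] [TopologicalSpace (WithTop K)]
    [OrderTopology (WithTop K)] {ν : Cardinal.{u}} (hν : ν.IsRegular) (hν' : ℵ₀ < ν)
    (hK : ν ≤ #K) : ν < noetherianType (WithTop K) := by
  have : CompactSpace (WithTop K) := compactSpace_of_wellFoundedLT
  by_contra! h
  obtain ⟨B, hB, hlt⟩ := exists_basis_mk_lt hν hν'
    (threadDichotomy_of_linearOrder hν.isRegularOrder) h
  exact (hK.trans (mk_le_mk_basis_withTop hB)).not_gt hlt

theorem isOpen_Iic_of_wellFoundedLT {X : Type u} [LinearOrder X] [WellFoundedLT X]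
    [TopologicalSpace X] [OrderTopology X] (z : X) : IsOpen (Iic z) := by
  by_cases h : (Ioi z).Nonempty
  · obtain ⟨b, hb, hmin⟩ := WellFoundedLT.exists_isLeast h
    convert! isOpen_Iio (a := b) using 1
    ext x
    exact ⟨fun hx => lt_of_le_of_lt hx hb, fun hx => not_lt.1 fun h' => (hmin h').not_gt hx⟩
  · convert! isOpen_univ using 1
    exact eq_univ_of_forall fun x => not_lt.1 fun h' => h ⟨x, h'⟩

theorem isOpLike_of_point_lt {X : Type u} {κ : Cardinal.{u}} {B : Set (Set X)}
    (hne : ∀ U ∈ B, U.Nonempty) (hp : ∀ p, #{U ∈ B | p ∈ U} < κ) : IsOpLike κ B := by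
  rintro ⟨V, hV⟩
  obtain ⟨p, hpV⟩ := hne V hV
  refine lt_of_le_of_lt ?_ (hp p)
  refine mk_le_of_injective (f := fun U : Set.Ici (⟨V, hV⟩ : B) =>
    (⟨U.1.1, U.1.2, U.2 hpV⟩ : {U ∈ B | p ∈ U})) fun U U' h => ?_
  exact Subtype.ext (Subtype.ext (congrArg (fun y => y.1) h))

/-- If a well-order with small proper initial segments has a small cofinal set, then adding a
top element gives a space of Noetherian type at most `κ`. -/
theorem noetherianType_withTop_le {κ : Cardinal.{u}} (hκ : ℵ₀ < κ)
    [TopologicalSpace (WithTop K)] [OrderTopology (WithTop K)]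
    (hK : ∀ k : K, #(Iic k) < κ) {A : Set K} (hA : IsCofinal A) (hAκ : #A < κ) :
    noetherianType (WithTop K) ≤ κ := by
  let A' : Set (WithTop K) := (↑) '' A
  have hA' : #A' < κ := mk_image_le.trans_lt hAκ
  have hcof : ∀ y : WithTop K, y < ⊤ → ∃ a ∈ A', y ≤ a := fun y hy => by
    obtain ⟨k, rfl⟩ := WithTop.ne_top_iff_exists.1 hy.ne
    obtain ⟨a, ha, hka⟩ := hA k
    exact ⟨a, ⟨a, ha, rfl⟩, WithTop.coe_le_coe.2 hka⟩
  have hlt : ∀ a ∈ A', a < ⊤ := by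
    rintro _ ⟨a, -, rfl⟩
    exact WithTop.coe_lt_top a
  have hIic : ∀ a ∈ A', #(Iic a) < κ := by
    rintro _ ⟨a, -, rfl⟩
    have : Iic (a : WithTop K) ⊆ (↑) '' Iic a := fun x hx => by
      obtain ⟨k, rfl⟩ := WithTop.ne_top_iff_exists.1 (lt_of_le_of_lt hx (WithTop.coe_lt_top a)).ne
      exact ⟨k, WithTop.coe_le_coe.1 hx, rfl⟩
    exact (mk_le_mk_of_subset this).trans_lt (mk_image_le.trans_lt (hK a))
  -- The points approached from the left by `A'`, including immediate successors of its elements.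
  -- Sending `z` to the first element of `A'` or `⊤` at or above it is injective on `L`, so `L` is
  -- small.
  let L : Set (WithTop K) := {z | ¬ IsMin z ∧ ∀ y < z, ∃ a ∈ A', y ≤ a ∧ a < z}
  have hL : #L < κ := by
    have hm : ∀ z : WithTop K, ∃ b, IsLeast {b ∈ insert ⊤ A' | z ≤ b} b := fun z =>
      WellFoundedLT.exists_isLeast ⟨⊤, mem_insert _ _, le_top⟩
    choose m hm using hm
    have hmono : ∀ z z', z' ∈ L → z < z' → m z < m z' := fun z z' hz' h => by
      obtain ⟨a, ha, hza, haz'⟩ := hz'.2 z h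
      exact ((hm z).2 ⟨mem_insert_of_mem _ ha, hza⟩).trans_lt (haz'.trans_le (hm z').1.2)
    have : #L ≤ #(insert ⊤ A' : Set (WithTop K)) := by
      refine mk_le_of_injective (f := fun z : L => ⟨m z, (hm z).1.1⟩) fun z z' h => ?_
      have h' : m z = m z' := congrArg Subtype.val h
      rcases lt_trichotomy z.1 z'.1 with h1 | h1 | h1
      · exact ((hmono _ _ z'.2 h1).ne h').elim
      · exact Subtype.ext h1
      · exact ((hmono _ _ z.2 h1).ne' h').elim
    exact this.trans_lt (mk_insert_le.trans_lt (add_lt_of_lt hκ.le hA' (one_lt_aleph0.trans hκ)))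
  -- `B₁` handles points of `L` and is small as a whole. The intervals in `B₂` cannot cross an
  -- element of `A'`, so those through `p` live in one initial segment `Iic a`, and none contains
  -- `⊤`. `B₃` handles the minimum.
  let B₁ : Set (Set (WithTop K)) := {U | ∃ a ∈ A', ∃ z ∈ L, a < z ∧ U = Ioc a z}
  let B₂ : Set (Set (WithTop K)) := {U | ∃ y z, y < z ∧ (∀ a ∈ A', y ≤ a → z ≤ a) ∧ U = Ioc y z}
  let B₃ : Set (Set (WithTop K)) := {U | ∃ z, IsMin z ∧ U = Iic z}
  have hIoc : ∀ y z : WithTop K, IsOpen (Ioc y z) := fun y z =>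
    isOpen_Ioi.inter (isOpen_Iic_of_wellFoundedLT z)
  refine noetherianType_le hκ.le (B := B₁ ∪ (B₂ ∪ B₃)) ?_ (isOpLike_of_point_lt ?_ fun p => ?_)
  · refine isTopologicalBasis_of_isOpen_of_nhds ?_ fun p V hp hV => ?_
    · rintro U (⟨a, -, z, -, -, rfl⟩ | ⟨y, z, -, -, rfl⟩ | ⟨z, -, rfl⟩)
      · exact hIoc _ _
      · exact hIoc _ _
      · exact isOpen_Iic_of_wellFoundedLT z
    · by_cases hmin : IsMin p
      · exact ⟨Iic p, Or.inr (Or.inr ⟨p, hmin, rfl⟩), mem_Iic.2 le_rfl, fun x hx => by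
          rwa [le_antisymm hx (hmin hx)]⟩
      · obtain ⟨y, hyp, hyV⟩ := exists_Ioc_subset_of_mem_nhds (hV.mem_nhds hp)
          (not_isMin_iff.1 hmin)
        by_cases hpL : p ∈ L
        · obtain ⟨a, ha, hya, hap⟩ := hpL.2 y hyp
          exact ⟨Ioc a p, Or.inl ⟨a, ha, p, hpL, hap, rfl⟩, ⟨hap, le_rfl⟩,
            (Ioc_subset_Ioc_left hya).trans hyV⟩
        · have : ∃ y' < p, ∀ a ∈ A', y' ≤ a → p ≤ a := by
            by_contra! h
            exact hpL ⟨hmin, h⟩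
          obtain ⟨y', hy'p, hy'⟩ := this
          exact ⟨Ioc (max y y') p, Or.inr (Or.inl ⟨_, p, max_lt hyp hy'p, fun a ha h =>
            hy' a ha ((le_max_right _ _).trans h), rfl⟩), ⟨max_lt hyp hy'p, le_rfl⟩,
            (Ioc_subset_Ioc_left (le_max_left _ _)).trans hyV⟩
  · rintro U (⟨a, -, z, -, h, rfl⟩ | ⟨y, z, h, -, rfl⟩ | ⟨z, -, rfl⟩)
    · exact ⟨z, h, le_rfl⟩
    · exact ⟨z, h, le_rfl⟩
    · exact ⟨z, mem_Iic.2 le_rfl⟩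
  · have h1 : #B₁ < κ := by
      have : B₁ ⊆ range fun q : A' × L => Ioc q.1.1 q.2.1 := by
        rintro U ⟨a, ha, z, hz, -, rfl⟩
        exact ⟨(⟨a, ha⟩, ⟨z, hz⟩), rfl⟩
      refine (mk_le_mk_of_subset this).trans_lt (mk_range_le.trans_lt ?_)
      rw [mk_prod, lift_id, lift_id]
      exact mul_lt_of_lt hκ.le hA' hL
    have h2 : #{U ∈ B₂ | p ∈ U} < κ := by
      by_cases hp : p = ⊤
      · refine (mk_le_mk_of_subset (t := ∅) ?_).trans_lt (by simpa using aleph0_pos.trans hκ)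
        rintro U ⟨⟨y, z, hyz, h, rfl⟩, hpU⟩
        subst hp
        have hz : z = ⊤ := top_le_iff.1 hpU.2
        obtain ⟨a, ha, hya⟩ := hcof y hpU.1
        exact ((hlt a ha).not_ge (hz ▸ h a ha hya)).elim
      · obtain ⟨a, ha, hpa⟩ := hcof p (lt_top_iff_ne_top.2 hp)
        have : {U ∈ B₂ | p ∈ U} ⊆ range fun q : Iic a × Iic a => Ioc q.1.1 q.2.1 := by
          rintro U ⟨⟨y, z, hyz, h, rfl⟩, hpU⟩
          have hza : z ≤ a := h a ha (hpU.1.le.trans hpa)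
          exact ⟨(⟨y, hyz.le.trans hza⟩, ⟨z, hza⟩), rfl⟩
        refine (mk_le_mk_of_subset this).trans_lt (mk_range_le.trans_lt ?_)
        rw [← mul_def]
        exact mul_lt_of_lt hκ.le (hIic a ha) (hIic a ha)
    have h3 : #{U ∈ B₃ | p ∈ U} < κ := by
      refine (mk_le_mk_of_subset (t := {Iic p}) ?_).trans_lt
        (by rw [mk_singleton]; exact one_lt_aleph0.trans hκ)
      rintro U ⟨⟨z, hz, rfl⟩, hpU⟩
      rw [mem_singleton_iff, le_antisymm hpU (hz hpU)]
    have hsub : {U ∈ B₁ ∪ (B₂ ∪ B₃) | p ∈ U} ⊆ B₁ ∪ ({U ∈ B₂ | p ∈ U} ∪ {U ∈ B₃ | p ∈ U}) := by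
      rintro U ⟨h | h | h, hpU⟩
      · exact Or.inl h
      · exact Or.inr (Or.inl ⟨h, hpU⟩)
      · exact Or.inr (Or.inr ⟨h, hpU⟩)
    refine (mk_le_mk_of_subset hsub).trans_lt ((mk_union_le _ _).trans_lt
      (add_lt_of_lt hκ.le h1 ((mk_union_le _ _).trans_lt (add_lt_of_lt hκ.le h2 h3))))

end WellOrder

/-! ### Successors of singular cardinals -/

/-- The lexicographic sum over `p : P` of the reversed initial segments `Iic (h p)` of `M`. -/
abbrev ReversedSegments {P M : Type u} [LinearOrder P] [LinearOrder M] (h : P → M) : Type u :=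
  {y : P ×ₗ Mᵒᵈ // OrderDual.ofDual (ofLex y).2 ≤ h (ofLex y).1}

namespace ReversedSegments

variable {P M : Type u} [LinearOrder P] [LinearOrder M] {h : P → M}

/-- The point of the block of `p` that corresponds to `m`. -/
def mk (h : P → M) (p : P) (m : M) (hm : m ≤ h p) : ReversedSegments h :=
  ⟨toLex (p, OrderDual.toDual m), hm⟩

/-- The index of the block that contains a point. -/
def fst (y : ReversedSegments h) : P := (ofLex y.1).1

/-- The position of a point in its block. -/
def snd (y : ReversedSegments h) : M := OrderDual.ofDual (ofLex y.1).2

@[simp] theorem fst_mk (p : P) (m : M) (hm : m ≤ h p) : (mk h p m hm).fst = p := rfl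

@[simp] theorem snd_mk (p : P) (m : M) (hm : m ≤ h p) : (mk h p m hm).snd = m := rfl

theorem snd_le (y : ReversedSegments h) : y.snd ≤ h y.fst := y.2

theorem lt_iff {y z : ReversedSegments h} :
    y < z ↔ y.fst < z.fst ∨ y.fst = z.fst ∧ z.snd < y.snd :=
  Prod.Lex.lt_iff

theorem le_iff {y z : ReversedSegments h} :
    y ≤ z ↔ y.fst < z.fst ∨ y.fst = z.fst ∧ z.snd ≤ y.snd :=
  Prod.Lex.le_iff

theorem exists_isLUB [WellFoundedLT P] [OrderTop P] [WellFoundedLT M]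
    (s : Set (ReversedSegments h)) : ∃ a, IsLUB s a := by
  obtain ⟨q, hq, hqmin⟩ := WellFoundedLT.exists_isLeast (s := {p : P | ∀ y ∈ s, y.fst ≤ p})
    ⟨⊤, fun _ _ => le_top⟩
  by_cases hex : ∃ y ∈ s, y.fst = q
  · obtain ⟨m, ⟨y, hy, hyq, rfl⟩, hmin⟩ := WellFoundedLT.exists_isLeast
      (s := {m : M | ∃ y ∈ s, y.fst = q ∧ y.snd = m}) (by
        obtain ⟨y, hy, hyq⟩ := hex
        exact ⟨_, y, hy, hyq, rfl⟩)
    refine ⟨y, IsGreatest.isLUB ⟨hy, fun z hz => le_iff.2 ?_⟩⟩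
    rcases (hq z hz).lt_or_eq with h' | h'
    · exact Or.inl (hyq ▸ h')
    · exact Or.inr ⟨h'.trans hyq.symm, hmin ⟨z, hz, h', rfl⟩⟩
  · push Not at hex
    refine ⟨mk h q (h q) le_rfl, fun z hz => le_iff.2 (Or.inl ((hq z hz).lt_of_ne (hex z hz))),
      fun z hz => le_iff.2 ?_⟩
    have h1 : q ≤ z.fst := hqmin fun y hy => by
      rcases le_iff.1 (hz hy) with h' | h'
      · exact h'.le
      · exact h'.1.le
    rcases h1.lt_or_eq with h' | h'
    · exact Or.inl h'
    · exact Or.inr ⟨h', by rw [snd_mk, h']; exact z.snd_le⟩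

theorem mk_le (h : P → M) : #(ReversedSegments h) ≤ #P * #M := by
  refine (mk_subtype_le _).trans ?_
  rw [mul_def]
  exact le_of_eq (mk_congr (ofLex.trans (Equiv.prodCongr (Equiv.refl P) OrderDual.ofDual)))

/-- At a left end point of a block of regular length `ν` with an index of small cofinality,
there are `ν` many base members that extend equally far to the left. -/
theorem exists_le_mk_setOf_subset {W : Type u} [LinearOrder W] {h : WithTop W → M}
    [TopologicalSpace (ReversedSegments h)] [OrderTopology (ReversedSegments h)]
    {ν : Cardinal.{u}} {b : W} (hb : ¬ IsMin b) (hbν : #(Iio b) < ν)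
    (hν : IsRegularOrder ν (Iio (h b)))
    {B : Set (Set (ReversedSegments h))} (hB : IsTopologicalBasis B) :
    ∃ c < b, ν ≤ #{U ∈ B | ∀ y : ReversedSegments h, c < y.fst → y.fst < b → y ∈ U} := by
  let e : Iio (h b) → ReversedSegments h := fun i => mk h b i.1 (le_of_lt i.2)
  let p : ReversedSegments h := mk h b (h b) le_rfl
  have hpe : ∀ i, p < e i := fun i => lt_iff.2 (Or.inr ⟨rfl, i.2⟩)
  have := hν.noMaxOrder
  obtain ⟨i₀⟩ := hν.nonempty
  have hright : ∀ U : {U ∈ B | p ∈ U}, ∃ j, ∀ i, j ≤ i → e i ∈ U.1 := by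
    rintro ⟨U, hUB, hpU⟩
    obtain ⟨u, hpu, huU⟩ := exists_Ico_subset_of_mem_nhds ((hB.isOpen hUB).mem_nhds hpU)
      ⟨e i₀, hpe i₀⟩
    rcases lt_iff.1 hpu with h1 | ⟨h1, h2⟩
    · exact ⟨i₀, fun i _ => huU ⟨(hpe i).le, lt_iff.2 (Or.inl h1)⟩⟩
    · obtain ⟨j, hj⟩ := exists_gt (⟨u.snd, h2⟩ : Iio (h b))
      exact ⟨j, fun i hi => huU ⟨(hpe i).le, lt_iff.2 (Or.inr ⟨h1, hj.trans_le hi⟩)⟩⟩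
  choose j hj using hright
  -- The points `e i` descend to `p` with coinitiality `ν`, so fewer than `ν` neighborhoods cannot
  -- form a local base.
  have hcard : ν ≤ #{U ∈ B | p ∈ U} := by
    by_contra! hlt
    obtain ⟨i, hi⟩ := hν.exists_gt_range hlt j
    obtain ⟨U, hUB, hpU, hU⟩ := hB.exists_subset_of_mem_open (hpe i) isOpen_Iio
    exact lt_irrefl (e i) (hU (hj ⟨U, hUB, hpU⟩ i (hi _).le))
  have hleft : ∀ U ∈ {U ∈ B | p ∈ U}, ∃ c < b,
      ∀ y : ReversedSegments h, c < y.fst → y.fst < b → y ∈ U := by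
    rintro U ⟨hUB, hpU⟩
    obtain ⟨c, hc⟩ := not_isMin_iff.1 hb
    obtain ⟨l, hlp, hlU⟩ := exists_Ioc_subset_of_mem_nhds ((hB.isOpen hUB).mem_nhds hpU)
      ⟨mk h c (h c) le_rfl, lt_iff.2 (Or.inl (WithTop.coe_lt_coe.2 hc))⟩
    have hl : l.fst < b := by
      rcases lt_iff.1 hlp with h1 | ⟨h1, h2⟩
      · exact h1
      · rw [fst_mk] at h1
        exact (h2.not_ge (by simpa [p, h1] using l.snd_le)).elim
    obtain ⟨d, hd⟩ := WithTop.ne_top_iff_exists.1 (hl.trans (WithTop.coe_lt_top b)).ne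
    rw [← hd] at hl
    exact ⟨d, WithTop.coe_lt_coe.1 hl, fun y h1 h2 =>
      hlU ⟨lt_iff.2 (Or.inl (hd ▸ h1)), (lt_iff.2 (Or.inl h2)).le⟩⟩
  by_contra! hcon
  -- Fewer than `ν` left bounds `c` are available, so by regularity one of them is shared by `ν`
  -- members.
  refine hcard.not_gt ((mk_le_mk_of_subset (t := ⋃ c : Iio b,
    {U ∈ B | ∀ y : ReversedSegments h, (c.1 : WithTop W) < y.fst → y.fst < b → y ∈ U})
    fun U hU => ?_).trans_lt (hν.isRegular.mk_iUnion_lt hbν fun c => hcon c.1 c.2))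
  obtain ⟨c, hc, hcU⟩ := hleft U hU
  exact mem_iUnion.2 ⟨⟨c, hc⟩, hU.1, hcU⟩

/-- For each `a`, pressing down on `S a` fixes the left bound `η a`. As `#A < κ`, all these bounds
lie below one `x`, and a base member just to the right of `x` serves every `a` simultaneously. -/
theorem exists_forall_le_mk_Ici {κ : Cardinal.{u}} {W : Type u} [LinearOrder W]
    (hW : IsRegularOrder κ W) {h : WithTop W → M}
    [TopologicalSpace (ReversedSegments h)] [OrderTopology (ReversedSegments h)]
    {A : Type u} (hA : #A < κ) {S : A → Set W} (hS : ∀ a, ¬ IsThin (S a))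
    (hmin : ∀ a, ∀ b ∈ S a, ¬ IsMin b) {ν : A → Cardinal.{u}} (hκν : ∀ a, κ ≤ ν a)
    (hν : ∀ a, ∀ b ∈ S a, IsRegularOrder (ν a) (Iio (h b)))
    {B : Set (Set (ReversedSegments h))} (hB : IsTopologicalBasis B) :
    ∃ V : B, ∀ a, ν a ≤ #(Set.Ici V) := by
  have h1 : ∀ a b, ∃ c, b ∈ S a → c < b ∧ ν a ≤ #{U ∈ B | ∀ y : ReversedSegments h,
      c < y.fst → y.fst < b → y ∈ U} := fun a b => by
    by_cases hb : b ∈ S a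
    · obtain ⟨c, hc⟩ := exists_le_mk_setOf_subset (hmin a b hb)
        ((hW.mk_Iio_lt b).trans_le (hκν a)) (hν a b hb) hB
      exact ⟨c, fun _ => hc⟩
    · exact ⟨b, fun h => (hb h).elim⟩
  choose f hf using h1
  choose η hη using fun a => IsThin.exists_fiber_of_regressive hW (hS a)
    fun b hb => (hf a b hb).1
  have := hW.noMaxOrder
  obtain ⟨x, hx⟩ := hW.exists_gt_range hA η
  obtain ⟨x', hx'⟩ := exists_gt x
  obtain ⟨x'', hx''⟩ := exists_gt x'
  let q : W → ReversedSegments h := fun w => mk h w (h w) le_rfl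
  have hq : StrictMono q := fun v w hvw => lt_iff.2 (Or.inl (WithTop.coe_lt_coe.2 hvw))
  obtain ⟨V, hVB, -, hV⟩ := hB.exists_subset_of_mem_open
    (show q x' ∈ Ioo (q x) (q x'') from ⟨hq hx', hq hx''⟩) isOpen_Ioo
  refine ⟨⟨V, hVB⟩, fun a => ?_⟩
  obtain ⟨b, ⟨hbS, hbη⟩, hb⟩ := IsThin.unbounded_of_not (hη a) x''
  refine (hf a b hbS).2.trans ?_
  rw [hbη]
  refine mk_le_of_injective (f := fun U => ⟨⟨U.1, U.2.1⟩, fun y hy => U.2.2 y ?_ ?_⟩)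
    fun U U' hUU' => Subtype.ext (congrArg (fun z => z.1.1) hUU')
  · refine lt_of_lt_of_le (WithTop.coe_lt_coe.2 (hx a)) ?_
    rcases lt_iff.1 (hV hy).1 with h' | h'
    · exact h'.le
    · exact h'.1.le
  · refine lt_of_lt_of_le ?_ (WithTop.coe_le_coe.2 hb)
    rcases lt_iff.1 (hV hy).2 with h' | ⟨h', h''⟩
    · exact h'
    · exact (h''.not_ge (by simpa [q, h'] using y.snd_le)).elim

end ReversedSegments

theorem isRegularOrder_Iio_ord {μ ν : Cardinal.{u}} (hν : ν.IsRegular) {m : μ.ord.ToType}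
    (hm : (m.toOrd : Ordinal.{u}) = ν.ord) : IsRegularOrder ν (Iio m) where
  isRegular := hν
  mk_eq := by
    have : #(Iio m) = (m.toOrd : Ordinal.{u}).card := rfl
    rw [this, hm, card_ord]
  mk_Iio_lt w := by
    have h1 : #(Iio w) ≤ #(Iio w.1) := mk_le_of_injective
      (f := fun v => ⟨v.1.1, v.2⟩) fun v v' h =>
        Subtype.ext (Subtype.ext (congrArg (fun z => z.1) h))
    have h2 : #(Iio w.1) = (w.1.toOrd : Ordinal.{u}).card := rfl
    refine h1.trans_lt ?_
    rw [h2, ← lt_ord, ← hm]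
    exact Ordinal.ToType.mk.symm.lt_iff_lt.2 w.2

/-- The successor of a singular cardinal is the Noetherian type of a compact linear order. -/
theorem exists_noetherianType_eq_succ_of_isSingular {μ : Cardinal.{u}} (hμ : μ.IsSingular) :
    ∃ (X : Type u) (_ : LinearOrder X) (_ : TopologicalSpace X) (_ : OrderTopology X)
      (_ : CompactSpace X), noetherianType X = Order.succ μ := by
  classical
  have hlim := hμ.isSuccLimit
  have hne : Nonempty μ.ord.ToType := nonempty_ord_toType hμ.pos.ne'
  have hmax : NoMaxOrder μ.ord.ToType := Cardinal.noMaxOrder hμ.aleph0_le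
  obtain ⟨A, hA, hAc⟩ := Order.exists_cof_eq μ.ord.ToType
  rw [Ordinal.cof_toType] at hAc
  have hAμ : #A < μ := hAc ▸ hμ.cof_ord_lt
  have hA0 : ℵ₀ ≤ #A := by
    rw [hAc, ← Ordinal.cof_toType]; exact Order.aleph0_le_cof
  have hsucc : Order.succ #A < μ := hlim.succ_lt hAμ
  have hreg : (Order.succ #A).IsRegular := isRegular_succ hA0
  -- The index length is the successor of the cofinality of `μ`. It is regular, still below `μ`, and
  -- long enough to carry one non-thin set per element of `A` and to bound `#A` many pressed-down
  -- values.
  let W := (Order.succ #A).ord.ToType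
  have hW : IsRegularOrder (Order.succ #A) W := hreg.isRegularOrder
  obtain ⟨S, hS, hSmin, hSdisj⟩ := exists_disjoint_not_isThin hA0 hW
  obtain ⟨φ⟩ : #A ≤ #W := by rw [hW.mk_eq]; exact Order.le_succ _
  -- The successor gives regularity, `#A` makes block lengths at least `#W`, and `#(Iio a.1)` makes
  -- the lengths cofinal in `μ`.
  let ν : A → Cardinal.{u} := fun a => Order.succ (max #A #(Iio a.1))
  have hνμ : ∀ a, ν a < μ := fun a =>
    hlim.succ_lt (max_lt hAμ (by simpa using Cardinal.mk_Iio_lt a.1))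
  have hνreg : ∀ a, (ν a).IsRegular := fun a => isRegular_succ (hA0.trans (le_max_left _ _))
  let m : A → μ.ord.ToType := fun a => Ordinal.ToType.mk ⟨(ν a).ord, ord_lt_ord.2 (hνμ a)⟩
  have hm : ∀ a, ((m a).toOrd : Ordinal.{u}) = (ν a).ord := fun a => by simp [m]
  let h : WithTop W → μ.ord.ToType := fun b =>
    if H : ∃ a : A, ∃ w ∈ S (φ a), b = (w : W) then m H.choose else Classical.arbitrary _
  have hh : ∀ a, ∀ w ∈ S (φ a), h (w : W) = m a := fun a w hw => by
    have H : ∃ a : A, ∃ w' ∈ S (φ a), (w : WithTop W) = (w' : W) := ⟨a, w, hw, rfl⟩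
    have : H.choose = a := by
      obtain ⟨w', hw', he⟩ := H.choose_spec
      rw [WithTop.coe_inj] at he
      subst he
      exact φ.injective (hSdisj _ _ _ hw' hw)
    simp only [h, dif_pos H, this]
  let _ : TopologicalSpace (ReversedSegments h) := Preorder.topology _
  have hot : OrderTopology (ReversedSegments h) := ⟨rfl⟩
  refine ⟨ReversedSegments h, inferInstance, inferInstance, hot,
    compactSpace_of_isLUB ReversedSegments.exists_isLUB, le_antisymm ?_ ?_⟩
  · have hcard : #(ReversedSegments h) ≤ μ := by
      refine (ReversedSegments.mk_le h).trans (mul_le_of_le hμ.aleph0_le ?_ (mk_ord_toType μ).le)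
      have : #(WithTop W) = #W + 1 := mk_option
      rw [this, hW.mk_eq]
      exact add_le_of_le hμ.aleph0_le hsucc.le (one_lt_aleph0.le.trans hμ.aleph0_le)
    obtain ⟨B, hB, hBμ⟩ := exists_basis_mk_le hμ.aleph0_le hcard
    exact noetherianType_le_succ hμ.aleph0_le hB hBμ
  · rw [Order.succ_le_iff]
    by_contra! hle
    obtain ⟨B, hB, hlike⟩ := exists_basis_isOpLike hle
    obtain ⟨V, hV⟩ := ReversedSegments.exists_forall_le_mk_Ici hW (h := h) (Order.lt_succ #A)
      (S := fun a => S (φ a)) (fun a => hS _) (fun a => hSmin _) (ν := ν)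
      (fun a => Order.succ_le_succ (le_max_left _ _))
      (fun a b hb => by rw [hh a b hb]; exact isRegularOrder_Iio_ord (hνreg a) (hm a)) hB
    have hVμ := hlike V
    -- If fewer than `μ` members lay above `V`, some `a` in the cofinal set would have `ν a`
    -- exceeding their number.
    obtain ⟨a, ha, hka⟩ := hA (Ordinal.ToType.mk ⟨(#(Set.Ici V)).ord, ord_lt_ord.2 hVμ⟩)
    have h1 : #(Set.Ici V) ≤ #(Iio a) := by
      have h2 : #(Iio a) = (a.toOrd : Ordinal.{u}).card := rfl
      rw [h2, ← ord_le]
      have h3 := Ordinal.ToType.mk.symm.monotone hka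
      rw [OrderIso.symm_apply_apply] at h3
      exact h3
    have h2 := hV ⟨a, ha⟩
    exact ((h1.trans (le_max_right _ _)).trans_lt (Order.lt_succ _)).not_ge h2

/-- The successor of a regular uncountable cardinal is the Noetherian type of a compact
linear order. -/
theorem exists_noetherianType_eq_succ_of_isRegular {μ : Cardinal.{u}} (hμ : μ.IsRegular)
    (hμ' : ℵ₀ < μ) :
    ∃ (X : Type u) (_ : LinearOrder X) (_ : TopologicalSpace X) (_ : OrderTopology X)
      (_ : CompactSpace X), noetherianType X = Order.succ μ := by
  have := hμ.noMaxOrder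
  let _ : TopologicalSpace (WithTop μ.ord.ToType) := Preorder.topology _
  have hot : OrderTopology (WithTop μ.ord.ToType) := ⟨rfl⟩
  refine ⟨WithTop μ.ord.ToType, inferInstance, inferInstance, hot,
    compactSpace_of_wellFoundedLT, le_antisymm ?_ ?_⟩
  · have hcard : #(WithTop μ.ord.ToType) ≤ μ := by
      have : #(WithTop μ.ord.ToType) = #μ.ord.ToType + 1 := mk_option
      rw [this, mk_ord_toType]
      exact add_le_of_le hμ'.le le_rfl (one_lt_aleph0.le.trans hμ'.le)
    obtain ⟨B, hB, hBμ⟩ := exists_basis_mk_le hμ'.le hcard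
    exact noetherianType_le_succ hμ'.le hB hBμ
  · exact Order.succ_le_iff.2 (lt_noetherianType_withTop hμ hμ' (mk_ord_toType μ).ge)

/-- Every singular cardinal is the Noetherian type of a compact linear order. -/
theorem exists_noetherianType_eq_of_isSingular {κ : Cardinal.{u}} (hκ : κ.IsSingular) :
    ∃ (X : Type u) (_ : LinearOrder X) (_ : TopologicalSpace X) (_ : OrderTopology X)
      (_ : CompactSpace X), noetherianType X = κ := by
  have hlim := hκ.isSuccLimit
  have hκ' : ℵ₀ < κ := hκ.aleph0_le.lt_of_ne fun h => not_isSingular_aleph0 (h ▸ hκ)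
  have hmax : NoMaxOrder κ.ord.ToType := Cardinal.noMaxOrder hκ.aleph0_le
  let _ : TopologicalSpace (WithTop κ.ord.ToType) := Preorder.topology _
  have hot : OrderTopology (WithTop κ.ord.ToType) := ⟨rfl⟩
  refine ⟨WithTop κ.ord.ToType, inferInstance, inferInstance, hot,
    compactSpace_of_wellFoundedLT, le_antisymm ?_ ?_⟩
  · obtain ⟨A, hA, hAc⟩ := Order.exists_cof_eq κ.ord.ToType
    rw [Ordinal.cof_toType] at hAc
    refine noetherianType_withTop_le hκ' (fun k => ?_) hA (hAc ▸ hκ.cof_ord_lt)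
    rw [← Iio_insert]
    exact mk_insert_le.trans_lt (add_lt_of_lt hκ.aleph0_le
      (by simpa using Cardinal.mk_Iio_lt k) (one_lt_aleph0.trans hκ'))
  · by_contra! hlt
    -- If the type were below `κ`, its successor would be a regular uncountable cardinal below `κ`,
    -- and hence smaller than the type itself.
    have h0 := aleph0_le_noetherianType (WithTop κ.ord.ToType)
    have := lt_noetherianType_withTop (isRegular_succ h0) (h0.trans_lt (Order.lt_succ _))
      ((hlim.succ_lt hlt).le.trans (mk_ord_toType κ).ge)
    exact (Order.le_succ _).not_gt this
end

/-! ### Assembly of the spectrum -/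

theorem noetherianType_ne_of_isWeaklyInaccessible {κ : Cardinal.{u}} (hκ : IsWeaklyInaccessible κ)
    (X : Type u) [LinearOrder X] [TopologicalSpace X] [OrderTopology X] [CompactSpace X] :
    noetherianType X ≠ κ :=
  hκ.noetherianType_ne (threadDichotomy_of_linearOrder hκ.2.1.isRegularOrder)

theorem mainTheorem8 :
    -- no compact linear order has weakly inaccessible Noetherian type
    (∀ κ : Cardinal.{u}, IsWeaklyInaccessible κ →
      ∀ (X : Type u) [LinearOrder X] [TopologicalSpace X] [OrderTopology X] [CompactSpace X],
        noetherianType X ≠ κ) ∧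
    -- nor does a product of fewer than `κ` compact linear orders have Noetherian type `κ`
    (∀ κ : Cardinal.{u}, IsWeaklyInaccessible κ →
      ∀ (ι : Type u) (X : ι → Type u) [∀ i, LinearOrder (X i)] [∀ i, TopologicalSpace (X i)]
        [∀ i, OrderTopology (X i)] [∀ i, CompactSpace (X i)],
        #ι < κ → noetherianType (∀ i, X i) ≠ κ) ∧
    -- the spectrum of Noetherian types of compact linear orders
    (∀ κ : Cardinal.{u}, ℵ₀ ≤ κ →
      ((∃ (X : Type u) (_ : LinearOrder X) (_ : TopologicalSpace X) (_ : OrderTopology X)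
          (_ : CompactSpace X), noetherianType X = κ) ↔
        κ ≠ ℵ₁ ∧ ¬ IsWeaklyInaccessible κ)) := by
  refine ⟨fun κ hκ X _ _ _ _ => noetherianType_ne_of_isWeaklyInaccessible hκ X,
    fun κ hκ ι X _ _ _ _ hι => ?_, fun κ hκ => ⟨?_, ?_⟩⟩
  · exact hκ.noetherianType_ne (ThreadDichotomy.pi hκ.2.1.isRegularOrder hκ.1 hι fun i =>
      threadDichotomy_of_linearOrder hκ.2.1.isRegularOrder)
  · rintro ⟨X, _, _, _, _, h⟩
    refine ⟨?_, fun hw => noetherianType_ne_of_isWeaklyInaccessible hw X h⟩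
    rw [← h]
    exact noetherianType_ne_aleph_one
      (threadDichotomy_of_linearOrder isRegular_aleph_one.isRegularOrder)
  · rintro ⟨h1, hw⟩
    rcases isRegular_or_isSingular hκ with hr | hs
    swap
    · exact exists_noetherianType_eq_of_isSingular hs
    rcases hκ.eq_or_lt with rfl | hlt
    · let _ : TopologicalSpace PUnit.{u + 1} := Preorder.topology _
      have hot : OrderTopology PUnit.{u + 1} := ⟨rfl⟩
      exact ⟨PUnit, inferInstance, inferInstance, hot, inferInstance, noetherianType_eq_aleph0⟩
    · have hnl : ¬ Order.IsSuccLimit κ := fun h => hw ⟨hlt, hr, h⟩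
      have hnp : ¬ Order.IsSuccPrelimit κ := fun h =>
        hnl (Cardinal.isSuccLimit_iff.2 ⟨hr.ne_zero, h⟩)
      obtain ⟨μ, rfl⟩ : ∃ μ, Order.succ μ = κ := by
        rw [Order.isSuccPrelimit_iff_succ_ne] at hnp
        push Not at hnp
        exact hnp
      have hμ : ℵ₀ ≤ μ := Order.lt_succ_iff.1 hlt
      -- Excluding `ℵ₁` is what makes the predecessor uncountable.
      have hμ' : ℵ₀ < μ := hμ.lt_of_ne fun h => h1 (by rw [← h, succ_aleph0])
      rcases isRegular_or_isSingular hμ with hr' | hs'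
      · exact exists_noetherianType_eq_succ_of_isRegular hr' hμ'
      · exact exists_noetherianType_eq_succ_of_isSingular hs'
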